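/- Let $n$ be a positive integer. For a permutation $\pi=\pi_1\cdots\pi_n$ of $[n]=\{1,\dots,n\}$ let $\operatorname{Pin}\pi=\{\pi_i \mid 1<i<n,\ \pi_{i-1}<\pi_i>\pi_{i+1}\}$ be its pinnacle set. Let $d\ge 1$ and let $S=\{s_1<s_2<\dots<s_d\}$ be admissible, that is, $S=\operatorname{Pin}\pi$ for some permutation $\pi$ of $[n]$. Let $\mathcal O(S)$ be the set of admissible orderings of $S$: the permutations $\sigma$ of $S$ for which there is a permutation $\pi$ of $[n]$ with $\operatorname{Pin}\pi=S$ whose pinnacles occur, from left to right, in the same order as in $\sigma$. Put $s_0=0$, $s_{d+1}=n+1$ and $n_i=s_{i+1}-s_i-1$ for $0\le i\le d$. For a finite sequence $\alpha=[\alpha_1,\dots,\alpha_k]$ of nonnegative integers let $|\alpha|=\sum_i\alpha_i$, let $r_j(\alpha)=\min\{i \mid \alpha_1+\dots+\alpha_i\ge j\}$ for $1\le j\le|\alpha|$, let $o(\alpha)$ be the number of $i$ with $\alpha_i=1$, let $2\oplus\alpha=[2,\alpha_1,\dots,\alpha_k]$, and let $$\delta_\alpha=\begin{cases}1&\text{if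 } j\le n_0+n_1+\dots+n_{r_j(\alpha)-1}\text{ for all }1\le j\le|\alpha|,\\0&\text{otherwise.}\end{cases}$$ Let $C'(d)$ be the set of sequences $\alpha=[\alpha_1,\dots,\alpha_{d-1}]$ with $\alpha_i\in\{0,1,2\}$ for all $i$ and $|\alpha|=d-1$. For $\alpha\in C'(d)$ the part $\alpha_i$ counts objects of rank $i+1$ (ranks run over $2,\dots,d$), and accordingly we put $r_j=r_j(\alpha)+1$ for $1\le j\le d-1$. Then $$\#\mathcal O(S)=\sum_{\alpha\in C'(d)}\delta_{2\oplus\alpha}\,2^{o(\alpha)}\prod_{i=0}^{d-2}\bigl(d+1-i-r_{d-1-i}\bigr).$$ -/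

import Mathlib

namespace Pinnacle

/-- Position `i` of the word `π₁ π₂ … πₙ` has a left and a right neighbour, and its value exceeds
both neighbouring values. -/
def IsPeak {n : ℕ} (π : Equiv.Perm (Fin n)) (i : Fin n) : Prop :=
  ∃ a b : Fin n, (a : ℕ) + 1 = i ∧ (b : ℕ) = i + 1 ∧ π a < π i ∧ π b < π i

instance {n : ℕ} (π : Equiv.Perm (Fin n)) : DecidablePred (IsPeak π) := fun i =>
  inferInstanceAs (Decidable
    (∃ a b : Fin n, (a : ℕ) + 1 = i ∧ (b : ℕ) = i + 1 ∧ π a < π i ∧ π b < π i))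

/-- The pinnacle set of a permutation. `Fin n` is identified with `{1, …, n}` via `x ↦ x + 1`. -/
def pin {n : ℕ} (π : Equiv.Perm (Fin n)) : Finset ℕ :=
  (Finset.univ.filter (IsPeak π)).image (fun i => (π i : ℕ) + 1)

/-- The pinnacles of `π`, listed from left to right. -/
def pinWord {n : ℕ} (π : Equiv.Perm (Fin n)) : List ℕ :=
  ((List.finRange n).filter (fun i => IsPeak π i)).map (fun i => (π i : ℕ) + 1)

/-- `S` is the pinnacle set of some permutation in the symmetric group on `{1, …, n}`. -/
def IsAdmissible (n : ℕ) (S : Finset ℕ) : Prop :=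
  ∃ π : Equiv.Perm (Fin n), pin π = S

/-- The admissible orderings of `S`: the arrangements `σ` of the elements of `S` (each used exactly
once) such that some permutation of `{1, …, n}` has pinnacle set `S` and its pinnacles occur, from
left to right, in the order `σ`. -/
def admissibleOrderings (n : ℕ) (S : Finset ℕ) : Set (List ℕ) :=
  {σ | σ.Nodup ∧ σ.toFinset = S ∧ ∃ π : Equiv.Perm (Fin n), pin π = S ∧ pinWord π = σ}

/-- `s₀ = 0`, then the elements `s₁ < ⋯ < s_d` of `S`, then `s_{d+1} = n + 1`. -/
def elt (n : ℕ) (S : Finset ℕ) (i : ℕ) : ℕ :=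
  (0 :: (S.sort (· ≤ ·) ++ [n + 1])).getD i 0

/-- `nᵢ = s_{i+1} - s_i - 1`, for `0 ≤ i ≤ d`. -/
def gap (n : ℕ) (S : Finset ℕ) (i : ℕ) : ℕ :=
  elt n S (i + 1) - elt n S i - 1

/-- `C'(d)`: the weak compositions of `d - 1` into `d - 1` parts from `{0, 1, 2}`.
The part `α_{i+1}` is `α i`. -/
def compositions (d : ℕ) : Finset (Fin (d - 1) → ℕ) :=
  (Fintype.piFinset (fun _ : Fin (d - 1) => Finset.Icc 0 2)).filter
    (fun α => ∑ i, α i = d - 1)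

/-- `r_j(α) = min {i | α₁ + ⋯ + αᵢ ≥ j}`, meaningful for `1 ≤ j ≤ |α|`. -/
noncomputable def rank {k : ℕ} (α : Fin k → ℕ) (j : ℕ) : ℕ :=
  sInf {i : ℕ | j ≤ ∑ m ∈ Finset.univ.filter (fun m : Fin k => (m : ℕ) < i), α m}

open Classical in
/-- `δ_α = 1` if `j ≤ n₀ + n₁ + ⋯ + n_{r_j - 1}` for all `1 ≤ j ≤ |α|`, and `δ_α = 0` otherwise. -/
noncomputable def delta (n : ℕ) (S : Finset ℕ) {k : ℕ} (α : Fin k → ℕ) : ℤ :=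
  if ∀ j ∈ Finset.Icc 1 (∑ i, α i), j ≤ ∑ i ∈ Finset.range (rank α j), gap n S i then 1 else 0

/-- The composition `2 ⊕ α = [2, α₁, …, α_k]`. -/
def twoPlus {k : ℕ} (α : Fin k → ℕ) : Fin (k + 1) → ℕ :=
  Fin.cons 2 α

/-- The number of parts of `α` that are equal to `1`. -/
def ones {k : ℕ} (α : Fin k → ℕ) : ℕ :=
  (Finset.univ.filter (fun i => α i = 1)).card

/-- In `C'(d)` the part `αᵢ` counts the chosen dales of rank `i + 1` (both dales of rank `1` are
always present and are left out of `α`). Hence the rank of the `j`-th smallest of the dales counted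
by `α` is `r_j(α) + 1`. -/
noncomputable def daleRank {k : ℕ} (α : Fin k → ℕ) (j : ℕ) : ℕ :=
  rank α j + 1

end Pinnacle

/-! Cutting a permutation at its d pinnacles leaves d + 1 dales. Each dale needs a letter below the
smaller of the pinnacles next to it, its bound. Distinct non-pinnacles can fill the dales exactly
when, for every pinnacle t, the dales with bound at most t are no more numerous than the
non-pinnacles below t. Necessity is a charging argument (`countP_daleMins_peaks_le`). Sufficiency is
Hall's theorem, with the surplus letters placed in a decreasing run at the front
(`exists_pinWord_eq`). So admissibility of an ordering depends only on its dale profile, that is, on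
how many dales each pinnacle bounds, and the condition becomes δ (`dalesFit_iff`, `delta_eq`).

Orderings with a given profile are counted by removing the largest entry M. At an end, M bounds one
dale. Between two neighbours it bounds none, and its insertion adds a dale bounded by the larger
neighbour. An entry has two neighbouring places and is the smaller neighbour as often as it bounds a
dale, so the number of places of each kind depends on the profile alone. The recursion is solved by
a power of 2 times a product of excesses of partial sums (`profileCount_eq`, via
`sum_mul_excessProd_update`). Finally `prod_excess_eq_prod_firstReach` trades this product over
ranks for the product over dales. -/

namespace Pinnacle

/-! ### Peaks of words and pinnacles of permutations -/

/-- The entries of a word that exceed both of their neighbours, from left to right. -/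
def peaks : List ℕ → List ℕ
  | a :: b :: c :: l => if a < b ∧ c < b then b :: peaks (b :: c :: l) else peaks (b :: c :: l)
  | _ => []

/-- The minima of consecutive entries of the word `p, s₁, …, s_d, ∞`: the upper bounds for the
dales of the pinnacle ordering `s₁ ⋯ s_d` when `p` stands on its left. -/
def daleMins (p : ℕ) : List ℕ → List ℕ
  | [] => [p]
  | s :: l => min p s :: daleMins s l

theorem peaks_cons_of_gt {a b : ℕ} (h : b < a) (l : List ℕ) :
    peaks (a :: b :: l) = peaks (b :: l) := by
  cases l with
  | nil => simp [peaks]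
  | cons c l => simp [peaks, h.le]

/-- `f` and `P` are arbitrary because the induction passes to the tail of the word, which no longer
comes from a permutation. -/
theorem filter_peak_finRange : ∀ (n : ℕ) (f : Fin n → ℕ) (P : Fin n → Prop) [DecidablePred P],
    (∀ i, P i ↔ ∃ a b : Fin n, (a : ℕ) + 1 = i ∧ (b : ℕ) = i + 1 ∧ f a < f i ∧ f b < f i) →
    ((List.finRange n).filter (fun i => P i)).map f = peaks (List.ofFn f)
  | 0, f, P, _, hP => by simp [peaks]
  | 1, f, P, _, hP => by
      have h0 : ¬ P 0 := by rw [hP]; rintro ⟨a, b, h1, -⟩; simp at h1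
      simp [peaks, List.finRange_succ, h0]
  | 2, f, P, _, hP => by
      have h0 : ¬ P 0 := by rw [hP]; rintro ⟨a, b, h1, -⟩; simp at h1
      have h1 : ¬ P 1 := by
        rw [hP]; rintro ⟨a, b, -, h1, -⟩; have := b.2; simp at h1; omega
      simp [peaks, List.finRange_succ, List.ofFn_succ, h0, h1]
  | n + 3, f, P, _, hP => by
      have ih := filter_peak_finRange (n + 2) (fun i => f i.succ)
        (fun i => ∃ a b : Fin (n + 2), (a : ℕ) + 1 = i ∧ (b : ℕ) = i + 1 ∧
          f a.succ < f i.succ ∧ f b.succ < f i.succ) (fun i => Iff.rfl)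
      have h0 : ¬ P 0 := by rw [hP]; rintro ⟨a, b, h1, -⟩; simp at h1
      have h1 : P 1 ↔ f 0 < f 1 ∧ f 2 < f 1 := by
        rw [hP]
        constructor
        · rintro ⟨a, b, h1, h2, h3, h4⟩
          obtain rfl : a = 0 := by ext; simpa using h1
          obtain rfl : b = 2 := by ext; rw [h2]; rfl
          exact ⟨h3, h4⟩
        · rintro ⟨h3, h4⟩
          exact ⟨0, 2, rfl, rfl, h3, h4⟩
      have h2 : ∀ i : Fin (n + 1), P i.succ.succ ↔ ∃ a b : Fin (n + 2), (a : ℕ) + 1 = i.succ ∧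
          (b : ℕ) = i.succ + 1 ∧ f a.succ < f i.succ.succ ∧ f b.succ < f i.succ.succ := by
        intro i
        rw [hP]
        constructor
        · rintro ⟨a, b, ha, hb, h3, h4⟩
          have ha0 : a ≠ 0 := by rintro rfl; simp at ha
          have hb0 : b ≠ 0 := by rintro rfl; simp at hb
          obtain ⟨a, rfl⟩ := Fin.exists_succ_eq.2 ha0
          obtain ⟨b, rfl⟩ := Fin.exists_succ_eq.2 hb0
          simp only [Fin.val_succ] at ha hb
          exact ⟨a, b, by simp only [Fin.val_succ]; omega, by simp only [Fin.val_succ]; omega,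
            h3, h4⟩
        · rintro ⟨a, b, ha, hb, h3, h4⟩
          simp only [Fin.val_succ] at ha hb
          exact ⟨a.succ, b.succ, by simp only [Fin.val_succ]; omega,
            by simp only [Fin.val_succ]; omega, h3, h4⟩
      -- Index `0` of the tail is never a peak of the tail. In the full word it is index `1`, which
      -- `h1` decides.
      rw [List.finRange_succ, List.filter_cons_of_neg (by simp)] at ih
      rw [List.finRange_succ, List.filter_cons_of_neg (by simpa using h0), List.finRange_succ,
        List.map_cons]
      have key : List.map f (List.filter (fun i => decide (P i))
          (List.map Fin.succ (List.map Fin.succ (List.finRange (n + 1))))) =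
          peaks (List.ofFn fun i : Fin (n + 2) => f i.succ) := by
        rw [← ih]
        simp only [List.filter_map, List.map_map]
        congr 1
        apply List.filter_congr
        intro i _
        simp only [Function.comp, h2]
      rw [List.filter_cons]
      simp only [List.ofFn_succ] at key ⊢
      have e1 : (Fin.succ 0 : Fin (n + 3)) = 1 := rfl
      have e2 : (Fin.succ (Fin.succ 0) : Fin (n + 3)) = 2 := rfl
      simp only [e1, e2] at key ⊢
      simp only [peaks, ← h1]
      rw [← key]
      by_cases hp : P 1 <;> simp [hp]

/-- The word `π₁ ⋯ πₙ` on the alphabet `{1, …, n}`. -/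
def word {n : ℕ} (π : Equiv.Perm (Fin n)) : List ℕ := List.ofFn fun i => (π i : ℕ) + 1

theorem pinWord_eq_peaks {n : ℕ} (π : Equiv.Perm (Fin n)) : pinWord π = peaks (word π) := by
  apply filter_peak_finRange n (fun i => (π i : ℕ) + 1) (IsPeak π)
  intro i
  simp [IsPeak]

theorem pin_eq_toFinset {n : ℕ} (π : Equiv.Perm (Fin n)) : pin π = (pinWord π).toFinset := by
  ext x
  simp [pin, pinWord]

theorem word_perm {n : ℕ} (π : Equiv.Perm (Fin n)) : (word π).Perm (List.range' 1 n) := by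
  rw [List.perm_ext_iff_of_nodup _ List.nodup_range']
  · intro x
    simp only [word, List.mem_ofFn, List.mem_range'_1]
    constructor
    · rintro ⟨i, rfl⟩
      have := (π i).2
      omega
    · rintro ⟨h1, h2⟩
      exact ⟨π.symm ⟨x - 1, by omega⟩, by simp; omega⟩
  · rw [word, List.nodup_ofFn]
    intro i j h
    exact π.injective (Fin.ext (by simpa using h))

theorem exists_word_eq {n : ℕ} {w : List ℕ} (h : w.Perm (List.range' 1 n)) :
    ∃ π : Equiv.Perm (Fin n), word π = w := by
  obtain rfl : n = w.length := by simp [h.length_eq]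
  have hmem : ∀ i : Fin w.length, 1 ≤ w[i] ∧ w[i] < 1 + w.length := fun i =>
    List.mem_range'_1.1 (h.mem_iff.1 (List.getElem_mem i.2))
  have hnd : w.Nodup := h.nodup_iff.2 List.nodup_range'
  let f : Fin w.length → Fin w.length := fun i => ⟨w[i] - 1, by have := hmem i; omega⟩
  have hf : Function.Injective f := by
    intro i j hij
    have h1 := hmem i
    have h2 := hmem j
    simp only [f, Fin.mk.injEq] at hij
    have : w[(i : ℕ)] = w[(j : ℕ)] := by
      simp only [Fin.getElem_fin] at *
      omega
    exact Fin.ext ((hnd.getElem_inj_iff).1 this)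
  refine ⟨Equiv.ofBijective f (Finite.injective_iff_bijective.1 hf), ?_⟩
  apply List.ext_getElem
  · simp [word]
  · intro i h1 h2
    have := hmem ⟨i, h2⟩
    simp only [word, List.getElem_ofFn, Equiv.ofBijective_apply, f]
    simp only [Fin.getElem_fin] at *
    omega

/-! ### Necessity of the filling condition -/

theorem countP_range'_lt (n t : ℕ) (h1 : 1 ≤ t) (h2 : t ≤ n + 1) :
    (List.range' 1 n).countP (· < t) = t - 1 := by
  obtain ⟨k, rfl⟩ := Nat.exists_eq_add_of_le' h1
  obtain ⟨m, rfl⟩ := Nat.exists_eq_add_of_le (show k ≤ n by omega)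
  rw [← List.range'_append_1, List.countP_append, List.countP_eq_length.2, List.countP_eq_zero.2]
  · simp
  · intro a ha; simp only [List.mem_range'_1] at ha; simp; omega
  · intro a ha; simp only [List.mem_range'_1] at ha; simp; omega

/-- Charge each pinnacle to itself and each dale to its least letter. During the scan `a` is the
last letter read, `p` the last pinnacle and `x` the least letter read since `p`. At a peak `b`, the
letter `x` pays for the dale bounded by `min p b`. -/
theorem countP_daleMins_peaks_le (t : ℕ) : ∀ (l : List ℕ) (a x p : ℕ), x ≤ a → x < p →
    (daleMins p (peaks (a :: l))).countP (· ≤ t) + (peaks (a :: l)).countP (· < t) ≤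
      (x :: l).countP (· < t)
  | [], a, x, p, hxa, hxp => by
      simp only [peaks, daleMins, List.countP_cons, List.countP_nil]
      grind
  | [b], a, x, p, hxa, hxp => by
      simp only [peaks, daleMins, List.countP_cons, List.countP_nil]
      grind
  | b :: c :: l, a, x, p, hxa, hxp => by
      by_cases hb : a < b ∧ c < b
      · have ih := countP_daleMins_peaks_le t l c c b le_rfl hb.2
        rw [peaks, if_pos hb, peaks_cons_of_gt hb.2]
        simp only [daleMins, List.countP_cons] at ih ⊢
        grind
      · have ih := countP_daleMins_peaks_le t (c :: l) b (min x b) p (min_le_right _ _) (by omega)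
        rw [peaks, if_neg hb]
        simp only [List.countP_cons] at ih ⊢
        grind

/-- The dales of a pinnacle ordering can be filled: below every pinnacle there are enough
non-pinnacles for the dales bounded by it. -/
def DalesFit (p : ℕ) (σ : List ℕ) : Prop :=
  ∀ t ∈ σ, (daleMins p σ).countP (· ≤ t) + σ.countP (· < t) + 1 ≤ t

theorem dalesFit_pinWord {n : ℕ} (π : Equiv.Perm (Fin n)) : DalesFit (n + 1) (pinWord π) := by
  intro t ht
  have hw := word_perm π
  have ht' : 1 ≤ t ∧ t ≤ n := by
    simp only [pinWord, List.mem_map] at ht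
    obtain ⟨i, -, rfl⟩ := ht
    have := (π i).2
    omega
  have hc := countP_range'_lt n t ht'.1 (by omega)
  rw [← hw.countP_eq] at hc
  rw [pinWord_eq_peaks]
  cases hl : word π with
  | nil => simp [pinWord_eq_peaks, hl, peaks] at ht
  | cons a l =>
    rw [hl] at hw hc
    have ha : a ∈ List.range' 1 n := hw.mem_iff.1 (by simp)
    rw [List.mem_range'_1] at ha
    have := countP_daleMins_peaks_le t l a a (n + 1) le_rfl (by omega)
    omega

/-! ### Sufficiency: choosing dale letters and building a permutation -/

theorem mem_of_mem_daleMins : ∀ (σ : List ℕ) (p t : ℕ), t ∈ daleMins p σ → t = p ∨ t ∈ σ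
  | [], p, t, h => by simp [daleMins] at h; simp [h]
  | s :: σ, p, t, h => by
      rcases List.mem_cons.1 h with h | h
      · rcases min_choice p s with h' | h' <;> simp [h, h']
      · rcases mem_of_mem_daleMins σ s t h with h | h <;> simp [h]

theorem card_filter_get_eq_countP (D : List ℕ) (P : ℕ → Prop) [DecidablePred P] :
    (Finset.univ.filter fun i : Fin D.length => P (D.get i)).card = D.countP (fun x => P x) := by
  conv_rhs => rw [← List.ofFn_get D, List.ofFn_eq_map, List.countP_map, List.countP_eq_length_filter]
  rfl

/-- A system of distinct representatives for the initial segments of a finite set of numbers. -/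
theorem exists_nodup_forall₂_lt (D : List ℕ) (N : Finset ℕ)
    (h : ∀ t ∈ D, D.countP (· ≤ t) ≤ (N.filter (· < t)).card) :
    ∃ v : List ℕ, v.Nodup ∧ (∀ x ∈ v, x ∈ N) ∧ List.Forall₂ (· < ·) v D := by
  have hall := (Finset.all_card_le_biUnion_card_iff_exists_injective
    (fun i : Fin D.length => N.filter (· < D.get i))).1 ?_
  · obtain ⟨f, hf, hfN⟩ := hall
    refine ⟨List.ofFn f, List.nodup_ofFn.2 hf, ?_, ?_⟩
    · intro x hx
      obtain ⟨i, rfl⟩ := (List.mem_ofFn' _ _).1 hx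
      exact (Finset.mem_filter.1 (hfN i)).1
    · rw [List.forall₂_iff_get]
      refine ⟨by simp, fun i h1 h2 => ?_⟩
      have := (Finset.mem_filter.1 (hfN ⟨i, h2⟩)).2
      simpa using this
  · intro s
    rcases s.eq_empty_or_nonempty with rfl | hs
    · simp
    -- The candidate sets form a chain, so Hall's condition for `s` only involves the largest bound
    -- in `s`.
    obtain ⟨m, hm, hmax⟩ := s.exists_max_image (fun i => D.get i) hs
    calc s.card ≤ (Finset.univ.filter fun i : Fin D.length => D.get i ≤ D.get m).card :=
          Finset.card_le_card fun i hi => by simpa using hmax i hi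
      _ = D.countP (· ≤ D.get m) := card_filter_get_eq_countP D (· ≤ D.get m)
      _ ≤ (N.filter (· < D.get m)).card := h _ (D.get_mem m)
      _ ≤ _ := Finset.card_le_card
          (Finset.subset_biUnion_of_mem (fun i : Fin D.length => N.filter (· < D.get i)) hm)

/-- The word `v₀ s₁ v₁ s₂ v₂ ⋯`. -/
def interleave : List ℕ → List ℕ → List ℕ
  | v :: vs, s :: ss => v :: s :: interleave vs ss
  | vs, [] => vs
  | [], ss => ss

theorem interleave_perm : ∀ vs ss : List ℕ, (interleave vs ss).Perm (vs ++ ss)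
  | v :: vs, s :: ss => by
      simp only [interleave, List.cons_append]
      exact ((interleave_perm vs ss).cons s).trans List.perm_middle.symm |>.cons v
  | [], [] => by simp [interleave]
  | v :: vs, [] => by simp [interleave]
  | [], s :: ss => by simp [interleave]

theorem peaks_interleave : ∀ (ss vs : List ℕ) (p : ℕ),
    List.Forall₂ (· < ·) vs (daleMins p ss) → peaks (interleave vs ss) = ss
  | [], _, p, h => by
      obtain ⟨v, vs, -, hvs, rfl⟩ := List.forall₂_cons_right_iff.1 h
      obtain rfl := List.forall₂_nil_right_iff.1 hvs
      simp [interleave, peaks]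
  | s :: ss, _, p, h => by
      obtain ⟨v, vs, hv, hvs, rfl⟩ := List.forall₂_cons_right_iff.1 h
      have ih := peaks_interleave ss vs s hvs
      have hhead : ∃ v' us, interleave vs ss = v' :: us ∧ v' < s := by
        cases ss with
        | nil =>
          obtain ⟨v', us, hv', -, rfl⟩ := List.forall₂_cons_right_iff.1 hvs
          exact ⟨v', us, by simp [interleave], hv'⟩
        | cons s' ss =>
          obtain ⟨v', us, hv', -, rfl⟩ := List.forall₂_cons_right_iff.1 hvs
          exact ⟨v', _, rfl, lt_of_lt_of_le hv' (min_le_left _ _)⟩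
      obtain ⟨v', us, he, hv's⟩ := hhead
      have hvs' : v < s := lt_of_lt_of_le hv (min_le_right _ _)
      rw [interleave, he, peaks, if_pos ⟨hvs', hv's⟩, peaks_cons_of_gt hv's, ← he, ih]

theorem peaks_cons_congr {a a' b : ℕ} (h : a < b) (h' : a' < b) (r : List ℕ) :
    peaks (a :: b :: r) = peaks (a' :: b :: r) := by
  cases r <;> simp [peaks, h, h']

/-- A decreasing run has no peak, and its last letter is at most `y`, hence below `b`. -/
theorem peaks_append_of_pairwise_gt {b : ℕ} (r : List ℕ) : ∀ (l : List ℕ) (y : ℕ),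
    l.Pairwise (· > ·) → y ∈ l → y < b → peaks (l ++ b :: r) = peaks (y :: b :: r)
  | [], y, _, h, _ => by simp at h
  | [x], y, _, h, _ => by simp at h; simp [h]
  | x :: x' :: l, y, hl, h, hy => by
      have hxx' : x' < x := List.rel_of_pairwise_cons hl (by simp)
      rw [List.cons_append, List.cons_append, peaks_cons_of_gt hxx', ← List.cons_append]
      rcases List.mem_cons.1 h with rfl | h
      · rw [peaks_append_of_pairwise_gt r (x' :: l) x' hl.of_cons (by simp) (hxx'.trans hy)]
        exact peaks_cons_congr (hxx'.trans hy) hy r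
      · exact peaks_append_of_pairwise_gt r (x' :: l) y hl.of_cons h hy

theorem mem_of_mem_daleMins_of_le {σ : List ℕ} {p t : ℕ} (hne : σ ≠ []) (hσ : ∀ s ∈ σ, s ≤ p)
    (h : t ∈ daleMins p σ) : t ∈ σ := by
  cases σ with
  | nil => exact absurd rfl hne
  | cons s σ =>
    rw [daleMins, min_eq_right (hσ s (by simp))] at h
    rcases List.mem_cons.1 h with h | h
    · simp [h]
    · rcases mem_of_mem_daleMins σ s t h with h | h <;> simp [h]

theorem exists_pinWord_eq {n : ℕ} {σ : List ℕ} (hne : σ ≠ []) (hnd : σ.Nodup)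
    (hσ : ∀ s ∈ σ, 1 ≤ s ∧ s ≤ n) (hfit : DalesFit (n + 1) σ) :
    ∃ π : Equiv.Perm (Fin n), pinWord π = σ := by
  have hcount : ∀ t, 1 ≤ t → t ≤ n →
      ((Finset.Icc 1 n \ σ.toFinset).filter (· < t)).card + σ.countP (· < t) = t - 1 := by
    intro t h1 h2
    have e1 : (σ.toFinset.filter (· < t)).card = σ.countP (· < t) := by
      rw [List.countP_eq_length_filter, ← List.toFinset_card_of_nodup (hnd.filter _),
        List.toFinset_filter]
      simp
    rw [← e1, ← Finset.card_union_of_disjoint]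
    · rw [show t - 1 = (Finset.Icc 1 (t - 1)).card by simp]
      congr 1
      ext x
      simp only [Finset.mem_union, Finset.mem_filter, Finset.mem_sdiff, Finset.mem_Icc,
        List.mem_toFinset]
      have := hσ x
      by_cases hx : x ∈ σ
      · have := this hx
        simp only [hx, not_true, and_false, false_and, true_and, false_or]
        omega
      · simp only [hx, not_false_eq_true, and_true, false_and, or_false]
        omega
    · rw [Finset.disjoint_left]
      intro x hx
      simp only [Finset.mem_filter, Finset.mem_sdiff, List.mem_toFinset] at hx ⊢
      tauto
  obtain ⟨v, hvnd, hvN, hv⟩ := exists_nodup_forall₂_lt (daleMins (n + 1) σ)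
    (Finset.Icc 1 n \ σ.toFinset) (by
      intro t ht
      have ht' := mem_of_mem_daleMins_of_le hne (fun s hs => (hσ s hs).2.trans n.le_succ) ht
      have h1 := hfit t ht'
      have h2 := hcount t (hσ t ht').1 (hσ t ht').2
      omega)
  obtain ⟨s, ss, rfl⟩ := List.exists_cons_of_ne_nil hne
  have hpk := peaks_interleave _ _ _ hv
  obtain ⟨v₀, vs, hv₀, hvs, rfl⟩ := List.forall₂_cons_right_iff.1 hv
  have hv₀s : v₀ < s := lt_of_lt_of_le hv₀ (min_le_right _ _)
  -- The unused letters join `v₀` in a decreasing run. Containing `v₀`, the run ends below the first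
  -- pinnacle.
  set R := (Finset.Icc 1 n \ (s :: ss).toFinset) \ (v₀ :: vs).toFinset with hR
  set A := (insert v₀ R).sort (· ≥ ·) with hA
  have hAgt : A.Pairwise (· > ·) := Finset.sortedGT_sort _ |>.pairwise
  have hv₀A : v₀ ∈ A := by simp [hA]
  have hv₀R : v₀ ∉ R := by simp [hR]
  have hAperm : A.Perm (v₀ :: R.toList) :=
    (Finset.sort_perm_toList _ _).trans (Finset.toList_insert hv₀R)
  have hperm : (A ++ s :: interleave vs ss).Perm (List.range' 1 n) := by
    have h1 : (A ++ s :: interleave vs ss).Perm (R.toList ++ ((v₀ :: vs) ++ (s :: ss))) := by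
      refine (hAperm.append_right _).trans ?_
      refine (List.perm_middle (l₁ := R.toList) (a := v₀)).symm.trans ?_
      exact (interleave_perm (v₀ :: vs) (s :: ss)).append_left _
    refine h1.trans ?_
    rw [List.perm_ext_iff_of_nodup _ List.nodup_range']
    · intro x
      rw [List.mem_append, List.mem_append, Finset.mem_toList, hR, Finset.mem_sdiff,
        Finset.mem_sdiff, List.mem_toFinset, List.mem_toFinset, Finset.mem_Icc,
        List.mem_range'_1]
      have h1 := hσ x
      have h2 := hvN x
      rw [Finset.mem_sdiff, Finset.mem_Icc] at h2
      constructor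
      · rintro (h | h | h)
        · omega
        · have := h2 h
          omega
        · have := h1 h
          omega
      · intro h
        by_cases hx1 : x ∈ v₀ :: vs
        · exact Or.inr (Or.inl hx1)
        by_cases hx2 : x ∈ s :: ss
        · exact Or.inr (Or.inr hx2)
        · exact Or.inl ⟨⟨by omega, hx2⟩, hx1⟩
    · rw [List.nodup_append', List.nodup_append']
      refine ⟨R.nodup_toList, ⟨hvnd, hnd, ?_⟩, ?_⟩
      · intro x h1 h2
        have := hvN x h1
        simp only [Finset.mem_sdiff, List.mem_toFinset] at this
        exact this.2 h2
      · intro x h1 h2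
        rw [Finset.mem_toList, hR] at h1
        simp only [Finset.mem_sdiff, List.mem_toFinset] at h1
        rcases List.mem_append.1 h2 with h2 | h2
        · exact h1.2 h2
        · exact h1.1.2 h2
  obtain ⟨π, hπ⟩ := exists_word_eq hperm
  refine ⟨π, ?_⟩
  rw [pinWord_eq_peaks, hπ, peaks_append_of_pairwise_gt _ A v₀ hAgt hv₀A hv₀s, ← interleave, hpk]

/-! ### Inserting a new maximum -/

/-- The dale minima created by inserting a new maximum `M` at the successive positions of a word
with left neighbour `p`. -/
def insertedMins (M p : ℕ) : List ℕ → List ℕ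
  | [] => [M]
  | y :: ys => min M (max p y) :: insertedMins M y ys

/-- Between neighbours y and y', the minimum of the two gives way to both, so their maximum is what
is added. `p < M` is the recursive case, where `p` is an earlier letter. `M < p` is the left
sentinel, and there `ys` must be nonempty, since otherwise `p` would disappear from the minima. -/
theorem map_daleMins_permutations'Aux (M : ℕ) : ∀ (ys : List ℕ) (p : ℕ), (∀ y ∈ ys, y < M) →
    (p < M ∨ (M < p ∧ ys ≠ [])) →
    (List.permutations'Aux M ys).map (fun τ => (daleMins p τ : Multiset ℕ)) =
      (insertedMins M p ys).map (fun z => z ::ₘ (daleMins p ys : Multiset ℕ))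
  | [], p, _, hp => by
      have hp : p < M := by simpa using hp
      simp only [List.permutations'Aux, daleMins, insertedMins, List.map_cons, List.map_nil,
        min_eq_left hp.le]
      rw [Multiset.cons_coe]
      congr 1
      exact Multiset.coe_eq_coe.2 (List.Perm.swap _ _ _)
  | y :: ys, p, hys, hp => by
      have hy : y < M := hys y (by simp)
      have ih := map_daleMins_permutations'Aux M ys y (fun z hz => hys z (by simp [hz])) (Or.inl hy)
      simp only [List.permutations'Aux, insertedMins, List.map_cons, List.map_map]
      congr 1
      · simp only [daleMins, min_eq_right hy.le, Multiset.cons_coe]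
        rcases hp with hp | ⟨hp, -⟩
        · rw [min_eq_left hp.le, min_eq_right (max_lt hp hy).le]
          rcases le_total p y with h | h
          · rw [min_eq_left h, max_eq_right h]
            exact Multiset.coe_eq_coe.2 (List.Perm.swap _ _ _)
          · rw [min_eq_right h, max_eq_left h]
        · rw [min_eq_right hp.le, min_eq_right (hy.trans hp).le,
            min_eq_left (hp.le.trans (le_max_left _ _))]
      · have := congrArg (List.map (fun s => min p y ::ₘ s)) ih
        simp only [List.map_map] at this
        refine Eq.trans ?_ (this.trans ?_)
        · apply List.map_congr_left
          intro τ _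
          simp [daleMins]
        · apply List.map_congr_left
          intro z _
          simp only [Function.comp, daleMins]
          rw [Multiset.cons_swap, Multiset.cons_coe]

/-- Each neighbouring pair gives its maximum to one list and its minimum to the other, so an entry
is counted once for each of its two sides. The left letter `p` has only one side. -/
theorem count_insertedMins_add_count_daleMins {M j : ℕ} (hj : j < M) : ∀ (ys : List ℕ) (p : ℕ),
    (∀ y ∈ ys, y < M) → p < M →
    (insertedMins M p ys).count j + (daleMins p ys).count j =
      2 * ys.count j + if p = j then 1 else 0
  | [], p, _, hp => by
      simp only [insertedMins, daleMins, List.count_cons, List.count_nil, beq_iff_eq]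
      grind
  | y :: ys, p, hys, hp => by
      have hy : y < M := hys y (by simp)
      have ih := count_insertedMins_add_count_daleMins hj ys y
        (fun z hz => hys z (by simp [hz])) hy
      simp only [insertedMins, daleMins, List.count_cons, beq_iff_eq] at ih ⊢
      grind

theorem count_insertedMins_add_count_daleMins_of_lt {M j p : ℕ} (hj : j < M) (hp : M < p)
    {ys : List ℕ} (hne : ys ≠ []) (hys : ∀ y ∈ ys, y < M) :
    (insertedMins M p ys).count j + (daleMins p ys).count j = 2 * ys.count j := by
  cases ys with
  | nil => exact absurd rfl hne
  | cons y ys =>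
    have hy : y < M := hys y (by simp)
    have ih := count_insertedMins_add_count_daleMins hj ys y
      (fun z hz => hys z (by simp [hz])) hy
    simp only [insertedMins, daleMins, List.count_cons, beq_iff_eq] at ih ⊢
    grind

theorem count_max_insertedMins {M : ℕ} : ∀ (ys : List ℕ) (p : ℕ),
    (∀ y ∈ ys, y < M) → p < M → (insertedMins M p ys).count M = 1
  | [], p, _, hp => by simp [insertedMins]
  | y :: ys, p, hys, hp => by
      have hy : y < M := hys y (by simp)
      have ih := count_max_insertedMins ys y (fun z hz => hys z (by simp [hz])) hy
      simp only [insertedMins, List.count_cons, beq_iff_eq] at ih ⊢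
      grind

theorem count_max_insertedMins_of_lt {M p : ℕ} (hp : M < p) {ys : List ℕ} (hne : ys ≠ [])
    (hys : ∀ y ∈ ys, y < M) : (insertedMins M p ys).count M = 2 := by
  cases ys with
  | nil => exact absurd rfl hne
  | cons y ys =>
    have ih := count_max_insertedMins ys y (fun z hz => hys z (by simp [hz])) (hys y (by simp))
    simp only [insertedMins, List.count_cons, beq_iff_eq] at ih ⊢
    grind

theorem mem_of_mem_insertedMins {M : ℕ} : ∀ (ys : List ℕ) (p z : ℕ),
    z ∈ insertedMins M p ys → z = M ∨ z = p ∨ z ∈ ys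
  | [], p, z, h => by simp [insertedMins] at h; simp [h]
  | y :: ys, p, z, h => by
      rcases List.mem_cons.1 h with h | h
      · grind
      · have := mem_of_mem_insertedMins ys y z h
        grind

theorem mem_of_mem_insertedMins_of_lt {M p : ℕ} (hp : M < p) {ys : List ℕ} (z : ℕ)
    (h : z ∈ insertedMins M p ys) : z = M ∨ z ∈ ys := by
  cases ys with
  | nil => simp [insertedMins] at h; simp [h]
  | cons y ys =>
    rcases List.mem_cons.1 h with h | h
    · grind
    · have := mem_of_mem_insertedMins ys y z h
      grind

theorem count_max_daleMins {M p : ℕ} (hp : M < p) {ys : List ℕ} (hys : ∀ y ∈ ys, y < M) :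
    (daleMins p ys).count M = 0 := by
  refine List.count_eq_zero.2 fun h => ?_
  rcases mem_of_mem_daleMins ys p M h with h | h
  · exact hp.ne h
  · exact lt_irrefl _ (hys M h)

/-! ### Recursion for the number of orderings with a given profile -/

/-- The number of arrangements of the entries of `l` in which the entry `x` is the minimum of
exactly `a x` dales. -/
def profileCount (p : ℕ) (l : List ℕ) (a : ℕ → ℤ) : ℕ :=
  l.permutations'.countP fun σ => ∀ x ∈ l, ((daleMins p σ).count x : ℤ) = a x

/-- The product over the suffixes of a list of the excess of the sum over the length. -/
def excessProd : List ℤ → ℤ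
  | [] => 1
  | b :: bs => ((b :: bs).sum - (b :: bs).length) * excessProd bs

theorem countP_permutations'Aux {M p : ℕ} (hp : M < p) {σ l : List ℕ} (hne : σ ≠ [])
    (hσ : ∀ y ∈ σ, y < M) (a : ℕ → ℤ) :
    (List.permutations'Aux M σ).countP (fun τ => ∀ x ∈ l, ((daleMins p τ).count x : ℤ) = a x) =
    (insertedMins M p σ).countP
      (fun z => ∀ x ∈ l, ((z :: daleMins p σ).count x : ℤ) = a x) := by
  have h := congrArg (List.countP fun m : Multiset ℕ => decide (∀ x ∈ l, (m.count x : ℤ) = a x))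
    (map_daleMins_permutations'Aux M σ p hσ (Or.inr ⟨hp, hne⟩))
  rw [List.countP_map, List.countP_map] at h
  simpa [Function.comp_def, Multiset.cons_coe, Multiset.coe_count] using h

theorem countP_eq_sum_ite_count (S : Finset ℕ) (P : ℕ → Prop) [DecidablePred P] (L : List ℕ)
    (hL : ∀ z ∈ L, P z → z ∈ S) :
    L.countP (fun z => P z) = ∑ j ∈ S, if P j then L.count j else 0 := by
  induction L with
  | nil => simp
  | cons z L ih =>
    rw [List.countP_cons, ih fun w hw => hL w (by simp [hw])]
    have : ∀ j ∈ S, (if P j then (z :: L).count j else 0) =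
        (if P j then L.count j else 0) + if j = z then (if P z then 1 else 0) else 0 := by
      intro j _
      rw [List.count_cons]
      grind
    rw [Finset.sum_congr rfl this, Finset.sum_add_distrib, Finset.sum_ite_eq']
    have := hL z (by simp)
    by_cases hz : P z <;> simp_all

theorem sum_map_sum_map_comm {α β : Type*} (f : α → β → ℤ) (l : List α) (m : List β) :
    (l.map fun x => (m.map (f x)).sum).sum = (m.map fun y => (l.map fun x => f x y).sum).sum := by
  induction l with
  | nil => simp
  | cons x l ih => simp [ih, List.sum_map_add]

theorem profileCount_cons_eq (p M : ℕ) (l : List ℕ) (a : ℕ → ℤ) :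
    (profileCount p (M :: l) a : ℤ) = (l.permutations'.map fun σ =>
      (((List.permutations'Aux M σ).countP
        fun τ => ∀ x ∈ M :: l, ((daleMins p τ).count x : ℤ) = a x : ℕ) : ℤ)).sum := by
  rw [profileCount, List.permutations', List.countP_flatMap, Nat.cast_list_sum, List.map_map]
  rfl

theorem countP_eq_sum_map_ite {α : Type*} (P : α → Prop) [DecidablePred P] (L : List α) :
    (L.countP (fun x => P x) : ℤ) = (L.map fun x => if P x then (1 : ℤ) else 0).sum := by
  induction L with
  | nil => simp
  | cons x L ih => by_cases h : P x <;> simp [h, ih, add_comm]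

/-- The largest entry bounds a dale only from an end of the word, and it cannot be at both ends. -/
theorem profileCount_cons_of_two {p M : ℕ} {l : List ℕ} (hp : M < p) (hl : ∀ y ∈ l, y < M)
    (hne : l ≠ []) {a : ℕ → ℤ} (ha : a M = 2) : (profileCount p (M :: l) a : ℤ) = 0 := by
  rw [profileCount_cons_eq]
  apply List.sum_eq_zero
  intro z hz
  obtain ⟨σ, hσ, rfl⟩ := List.mem_map.1 hz
  have hσ := List.mem_permutations'.1 hσ
  have hσl : ∀ y ∈ σ, y < M := fun y hy => hl y (hσ.mem_iff.1 hy)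
  rw [countP_permutations'Aux hp (fun h => hne (by simpa [h] using hσ)) hσl, Nat.cast_eq_zero,
    List.countP_eq_zero]
  intro z _ h
  have := of_decide_eq_true h M (by simp)
  rw [List.count_cons, count_max_daleMins hp hσl, ha] at this
  split_ifs at this <;> simp at this

/-- The factor 2 is the choice of end for `M`. The other counts do not change. -/
theorem profileCount_cons_of_one {p M : ℕ} {l : List ℕ} (hp : M < p) (hl : ∀ y ∈ l, y < M)
    (hne : l ≠ []) {a : ℕ → ℤ} (ha : a M = 1) :
    (profileCount p (M :: l) a : ℤ) = 2 * profileCount p l a := by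
  rw [profileCount_cons_eq, profileCount, countP_eq_sum_map_ite, ← List.sum_map_mul_left]
  congr 1
  apply List.map_congr_left
  intro σ hσ
  have hσ := List.mem_permutations'.1 hσ
  have hσl : ∀ y ∈ σ, y < M := fun y hy => hl y (hσ.mem_iff.1 hy)
  have hσne : σ ≠ [] := fun h => hne (by simpa [h] using hσ)
  rw [countP_permutations'Aux hp hσne hσl]
  have key : ∀ z, (∀ x ∈ M :: l, ((z :: daleMins p σ).count x : ℤ) = a x) ↔
      z = M ∧ ∀ x ∈ l, ((daleMins p σ).count x : ℤ) = a x := by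
    intro z
    rw [List.forall_mem_cons, List.count_cons, count_max_daleMins hp hσl, ha]
    have : ((0 + (if z == M then 1 else 0) : ℕ) : ℤ) = 1 ↔ z = M := by
      by_cases h : z = M <;> simp [h]
    rw [this]
    refine and_congr_right fun hz => forall₂_congr fun x hx => ?_
    rw [List.count_cons_of_ne]
    have := hl x hx
    omega
  simp only [key]
  by_cases h : ∀ x ∈ l, ((daleMins p σ).count x : ℤ) = a x
  · have := count_max_insertedMins_of_lt hp hσne hσl
    rw [List.count_eq_countP] at this
    have hM : (insertedMins M p σ).countP (fun z => z = M) = 2 := by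
      rw [← this]
      exact List.countP_congr (by simp)
    simp only [eq_true h, and_true, if_true, hM]
    norm_num
  · simp [h]

/-- Here `M` is interior and its insertion adds one dale bounded by some `j`. Beforehand `j` bounded
`a j - 1` dales, which leaves `2 - (a j - 1)` suitable places. -/
theorem profileCount_cons_of_zero {p M : ℕ} {l : List ℕ} (hp : M < p) (hl : ∀ y ∈ l, y < M)
    (hne : l ≠ []) (hnd : l.Nodup) {a : ℕ → ℤ} (ha : a M = 0) :
    (profileCount p (M :: l) a : ℤ) =
      (l.map fun j => (3 - a j) * profileCount p l (Function.update a j (a j - 1))).sum := by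
  have hcount : ∀ b, (profileCount p l b : ℤ) = (l.permutations'.map fun σ =>
      if ∀ x ∈ l, ((daleMins p σ).count x : ℤ) = b x then (1 : ℤ) else 0).sum :=
    fun b => countP_eq_sum_map_ite _ _
  simp only [profileCount_cons_eq, hcount, ← List.sum_map_mul_left]
  rw [sum_map_sum_map_comm]
  congr 1
  apply List.map_congr_left
  intro σ hσ
  have hσ := List.mem_permutations'.1 hσ
  have hσl : ∀ y ∈ σ, y < M := fun y hy => hl y (hσ.mem_iff.1 hy)
  have hσne : σ ≠ [] := fun h => hne (by simpa [h] using hσ)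
  rw [countP_permutations'Aux hp hσne hσl, countP_eq_sum_ite_count l.toFinset, Nat.cast_sum,
    List.sum_toFinset _ hnd]
  · congr 1
    apply List.map_congr_left
    intro j hj
    have key : (∀ x ∈ M :: l, ((j :: daleMins p σ).count x : ℤ) = a x) ↔
        ∀ x ∈ l, ((daleMins p σ).count x : ℤ) = Function.update a j (a j - 1) x := by
      have hjM := hl j hj
      rw [List.forall_mem_cons, List.count_cons, count_max_daleMins hp hσl, ha]
      have : ((0 + (if j == M then 1 else 0) : ℕ) : ℤ) = 0 ↔ True := by
        simp [hjM.ne]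
      rw [this, true_and]
      refine forall₂_congr fun x hx => ?_
      rw [List.count_cons, Function.update_apply]
      by_cases h : x = j
      · subst h
        simp
        constructor <;> intro <;> linarith
      · simp [h, Ne.symm h]
    simp only [key]
    split_ifs with h
    · have h1 := h j hj
      have h2 := count_insertedMins_add_count_daleMins_of_lt (hl j hj) hp hσne hσl
      rw [Function.update_self] at h1
      rw [hσ.count_eq, List.count_eq_one_of_mem hnd hj] at h2
      zify at h2
      linarith
    · simp
  · intro z hz h
    rcases mem_of_mem_insertedMins_of_lt hp z hz with rfl | hz
    · have := h z (by simp)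
      rw [List.count_cons, count_max_daleMins hp hσl, ha] at this
      simp at this
    · exact List.mem_toFinset.2 (hσ.mem_iff.1 hz)

/-! ### Closed form of the profile count -/

/-- Turns the weight `3 - a j` into `a j`: lowering a 1 loses a part equal to 1, lowering a 2 gains
one. -/
theorem two_pow_countP_update {l : List ℕ} (hnd : l.Nodup) {j : ℕ} (hj : j ∈ l) (a : ℕ → ℤ)
    (ha : a j = 1 ∨ a j = 2) :
    (3 - a j) * 2 ^ l.countP (fun x => Function.update a j (a j - 1) x = 1) =
      a j * 2 ^ l.countP (fun x => a x = 1) := by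
  induction l with
  | nil => simp at hj
  | cons x l ih =>
    obtain ⟨hx, hnd⟩ := List.nodup_cons.1 hnd
    simp only [List.countP_cons, decide_eq_true_eq]
    rcases List.mem_cons.1 hj with rfl | hj
    · have : l.countP (fun x => Function.update a j (a j - 1) x = 1) =
          l.countP (fun x => a x = 1) := by
        apply List.countP_congr
        intro y hy
        rw [Function.update_of_ne (by rintro rfl; exact hx hy)]
      rw [this, Function.update_self]
      rcases ha with h | h <;> simp [h, pow_succ] <;> ring
    · rw [Function.update_of_ne (by rintro rfl; exact hx hj), pow_add, pow_add, ← mul_assoc,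
        ih hnd hj, mul_assoc]

/-- The product over the suffixes of a list of the excess of the sum over the length, minus one. -/
def excessSubOneProd : List ℤ → ℤ
  | [] => 1
  | b :: bs => ((b :: bs).sum - (b :: bs).length - 1) * excessSubOneProd bs

/-- With e the excess of the whole list, every summand contains the factor e - 1. In the induction
the head's `a M` raises the tail's coefficient to e, which completes the product. -/
theorem sum_mul_excessProd_update {l : List ℕ} (hnd : l.Nodup) (a : ℕ → ℤ) :
    (l.map fun j => a j * excessProd (l.map (Function.update a j (a j - 1)))).sum =
      ((l.map a).sum - l.length - 1) * excessProd (l.map a) + excessSubOneProd (l.map a) := by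
  induction l with
  | nil => simp [excessProd, excessSubOneProd]
  | cons M l ih =>
    obtain ⟨hM, hnd⟩ := List.nodup_cons.1 hnd
    have h1 : l.map (Function.update a M (a M - 1)) = l.map a :=
      List.map_congr_left fun y hy => Function.update_of_ne (by rintro rfl; exact hM hy) _ _
    have hsum : ∀ l : List ℕ, l.Nodup → ∀ j ∈ l,
        (l.map (Function.update a j (a j - 1))).sum = (l.map a).sum - 1 := by
      intro l hl j hj
      rw [← List.sum_toFinset _ hl, ← List.sum_toFinset _ hl,
        Finset.sum_update_of_mem (by simpa using hj),
        ← Finset.sum_sdiff (Finset.singleton_subset_iff.2 (List.mem_toFinset.2 hj))]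
      simp
      ring
    have h2 : (l.map fun j => a j *
        excessProd ((M :: l).map (Function.update a j (a j - 1)))) = l.map fun j =>
          ((a M :: l.map a).sum - (M :: l).length - 1) *
            (a j * excessProd (l.map (Function.update a j (a j - 1)))) := by
      apply List.map_congr_left
      intro j hj
      have hjM : M ≠ j := by rintro rfl; exact hM hj
      simp only [List.map_cons, excessProd, List.sum_cons, hsum l hnd j hj, List.length_cons,
        List.length_map, Function.update_of_ne hjM]
      ring
    rw [List.map_cons, List.sum_cons, h2, List.sum_map_mul_left, ih hnd]
    simp only [List.map_cons, h1, excessProd, excessSubOneProd, Function.update_self,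
      List.sum_cons, List.length_cons, List.length_map]
    push_cast
    ring

/-- The excess of a suffix starts at 0 and grows by at most 1 per entry. It cannot become positive
without equalling 1, where a factor vanishes. -/
theorem excessSubOneProd_eq_zero_or (b : List ℤ) (hb : ∀ x ∈ b, x ≤ 2) :
    excessSubOneProd b = 0 ∨ b.sum ≤ b.length := by
  induction b with
  | nil => simp
  | cons x b ih =>
    have hx := hb x (by simp)
    simp only [excessSubOneProd, List.sum_cons, List.length_cons]
    rcases ih (fun y hy => hb y (by simp [hy])) with h | h
    · simp [h]
    · push_cast
      rcases (show x + b.sum ≤ b.length + 1 ∨ x + b.sum - (b.length + 1) - 1 = 0 by omega) with h | h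
      · exact Or.inr h
      · simp [h]

theorem profileCount_eq_zero_of_neg {p j : ℕ} {l : List ℕ} {a : ℕ → ℤ} (hj : j ∈ l)
    (ha : a j < 0) : profileCount p l a = 0 := by
  rw [profileCount, List.countP_eq_zero]
  intro σ _ h
  have := of_decide_eq_true h j hj
  omega

/-- The number of arrangements with a prescribed dale profile. -/
theorem profileCount_eq {p : ℕ} {l : List ℕ} (hl : l.Pairwise (· > ·)) (hp : ∀ x ∈ l, x < p)
    (hne : l ≠ []) (a : ℕ → ℤ) (ha : ∀ x ∈ l, 0 ≤ a x ∧ a x ≤ 2)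
    (hsum : (l.map a).sum = l.length + 1) :
    (profileCount p l a : ℤ) = 2 ^ l.countP (fun x => a x = 1) * excessProd (l.map a) := by
  induction l generalizing a with
  | nil => exact absurd rfl hne
  | cons M l ih =>
    have hMp : M < p := hp M (by simp)
    by_cases hl0 : l = []
    · subst hl0
      have h2 : a M = 2 := by simpa using hsum
      simp [profileCount, List.permutations'Aux, daleMins, hMp.le, h2, excessProd]
    have hlM : ∀ y ∈ l, y < M := fun y hy => List.rel_of_pairwise_cons hl hy
    have hnd : l.Nodup := hl.of_cons.imp fun h => (ne_of_gt h)
    have hMl : M ∉ l := fun h => lt_irrefl _ (hlM M h)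
    have hpl : ∀ x ∈ l, x < p := fun x hx => hp x (by simp [hx])
    have hal : ∀ x ∈ l, 0 ≤ a x ∧ a x ≤ 2 := fun x hx => ha x (by simp [hx])
    -- The full list has excess 1.
    have hQ : excessProd ((M :: l).map a) = excessProd (l.map a) := by
      simp only [List.map_cons, excessProd, List.length_cons, List.length_map] at hsum ⊢
      rw [hsum]
      push_cast
      ring
    rw [hQ, List.countP_cons]
    simp only [List.map_cons, List.sum_cons, List.length_cons] at hsum
    push_cast at hsum
    obtain h0 | h1 | h2 : a M = 0 ∨ a M = 1 ∨ a M = 2 := by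
      have := ha M (by simp)
      omega
    · rw [profileCount_cons_of_zero hMp hlM hl0 hnd h0]
      have hterm : ∀ j ∈ l, (3 - a j) * profileCount p l (Function.update a j (a j - 1)) =
          2 ^ l.countP (fun x => a x = 1) *
            (a j * excessProd (l.map (Function.update a j (a j - 1)))) := by
        intro j hj
        -- Lowering a zero leaves the range of the induction hypothesis, but then both sides vanish.
        rcases eq_or_ne (a j) 0 with hj0 | hj0
        · rw [profileCount_eq_zero_of_neg hj (by simp [hj0]), hj0]
          simp
        · have haj := hal j hj
          rw [ih hl.of_cons hpl hl0, ← mul_assoc, two_pow_countP_update hnd hj a (by omega)]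
          · ring
          · intro x hx
            have := hal x hx
            rw [Function.update_apply]
            split_ifs <;> omega
          · rw [← List.sum_toFinset _ hnd, Finset.sum_update_of_mem (by simpa using hj)]
            have := Finset.sum_sdiff (f := a)
              (Finset.singleton_subset_iff.2 (List.mem_toFinset.2 hj))
            rw [List.sum_toFinset _ hnd, Finset.sum_singleton] at this
            linarith
      rw [List.map_congr_left hterm, List.sum_map_mul_left, sum_mul_excessProd_update hnd]
      -- The tail has excess 2, so the coefficient is 1 and the remainder term is zero.
      rcases excessSubOneProd_eq_zero_or (l.map a) (by
        intro x hx
        obtain ⟨y, hy, rfl⟩ := List.mem_map.1 hx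
        exact (hal y hy).2) with h | h
      · rw [h, show (l.map a).sum = l.length + 2 by linarith]
        simp [h0]
      · rw [List.length_map] at h
        linarith
    · rw [profileCount_cons_of_one hMp hlM hl0 h1, ih hl.of_cons hpl hl0 a hal (by linarith)]
      simp [h1, pow_succ]
      ring
    · rw [profileCount_cons_of_two hMp hlM hl0 h2]
      obtain ⟨x, l, rfl⟩ := List.exists_cons_of_ne_nil hl0
      -- The tail has excess 0, which kills the product.
      have : ((x :: l).map a).sum - ((x :: l).map a).length = 0 := by
        rw [List.length_map, List.length_cons]
        push_cast
        simp only [List.length_cons] at hsum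
        push_cast at hsum
        linarith
      rw [List.map_cons] at this ⊢
      rw [excessProd, this]
      simp

/-! ### Bounds on dale counts -/

theorem count_daleMins_of_min {m : ℕ} : ∀ (σ : List ℕ) (p : ℕ), m < p → (∀ s ∈ σ, m ≤ s) →
    σ.Nodup → (daleMins p σ).count m = 2 * σ.count m
  | [], p, hp, _, _ => by simp [daleMins, hp.ne']
  | s :: σ, p, hp, hσ, hnd => by
      obtain ⟨hs, hnd⟩ := List.nodup_cons.1 hnd
      rcases (hσ s (by simp)).eq_or_lt with rfl | hms
      · have hgt : ∀ s ∈ σ, m < s := fun s h =>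
          lt_of_le_of_ne (hσ s (by simp [h])) (by rintro rfl; exact hs h)
        rw [daleMins, min_eq_right hp.le, List.count_cons_self, List.count_cons_self,
          List.count_eq_zero_of_not_mem hs]
        cases σ with
        | nil => simp [daleMins]
        | cons t σ =>
          have ht := hgt t (by simp)
          rw [daleMins, min_eq_left ht.le, List.count_cons_self, List.count_eq_zero_of_not_mem]
          intro h
          rcases mem_of_mem_daleMins _ _ _ h with h | h
          · omega
          · exact lt_irrefl _ (hgt m (by simp [h]))
      · rw [daleMins, List.count_cons_of_ne (by omega), List.count_cons_of_ne (by omega)]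
        exact count_daleMins_of_min σ s hms (fun t ht => hσ t (by simp [ht])) hnd

theorem count_daleMins_le (j : ℕ) : ∀ (σ : List ℕ) (p : ℕ),
    (daleMins p σ).count j ≤ 2 * σ.count j + if p = j then 1 else 0
  | [], p => by simp [daleMins, List.count_singleton]
  | s :: σ, p => by
      have := count_daleMins_le j σ s
      simp only [daleMins, List.count_cons, beq_iff_eq]
      grind

theorem length_daleMins : ∀ (σ : List ℕ) (p : ℕ), (daleMins p σ).length = σ.length + 1
  | [], p => rfl
  | s :: σ, p => by simp [daleMins, length_daleMins σ s]

/-! ### From excesses of partial sums to ranks -/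

theorem excessProd_reverse_map_range (b : ℕ → ℤ) (d : ℕ) :
    excessProd ((List.range d).map b).reverse =
      ∏ m ∈ Finset.range d, ((∑ i ∈ Finset.range (m + 1), b i) - (m + 1)) := by
  induction d with
  | zero => simp [excessProd]
  | succ d ih =>
    have hsum : ((List.range d).map b).sum = ∑ i ∈ Finset.range d, b i := by
      rw [← List.sum_toFinset _ List.nodup_range, List.toFinset_range]
    rw [List.range_succ, List.map_append, List.map_singleton, List.reverse_append,
      List.reverse_singleton, List.singleton_append, excessProd, ih, Finset.prod_range_succ,
      mul_comm, List.sum_cons, List.sum_reverse, hsum, Finset.sum_range_succ b d]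
    simp [add_comm]

/-- The position of the first partial sum that reaches `j`. -/
noncomputable def firstReach (b : ℕ → ℕ) (j : ℕ) : ℕ :=
  sInf {i : ℕ | j ≤ ∑ m ∈ Finset.range i, b m}

theorem firstReach_eq {b : ℕ → ℕ} {j m : ℕ} (h1 : ∑ i ∈ Finset.range m, b i < j)
    (h2 : j ≤ ∑ i ∈ Finset.range (m + 1), b i) : firstReach b j = m + 1 := by
  apply le_antisymm
  · exact Nat.sInf_le h2
  · refine le_csInf ⟨m + 1, h2⟩ fun i hi => ?_
    by_contra hlt
    have : ∑ i ∈ Finset.range i, b i ≤ ∑ i ∈ Finset.range m, b i :=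
      Finset.sum_le_sum_of_subset (Finset.range_mono (by omega))
    have hi : j ≤ _ := hi
    omega

/-- A dale in place `j` found at step `k` has factor `j + 1 - k`. A part 0 gives an excess factor
and no dale, a part 1 one equal factor on each side, a part 2 one dale factor too many. The
factorial of the surplus keeps account of the difference. The second alternative covers partial sums
that have dropped below `k`, after the excess factor 0. -/
theorem prod_excess_eq_prod_firstReach_aux (b : ℕ → ℕ) (hb : ∀ i, b i ≤ 2) (k : ℕ) :
    (k ≤ ∑ i ∈ Finset.range k, b i ∧
      ∏ j ∈ Finset.range (∑ i ∈ Finset.range k, b i), ((j : ℤ) + 2 - firstReach b (j + 1)) =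
      (∏ m ∈ Finset.range k, ((∑ i ∈ Finset.range (m + 1), (b i : ℤ)) - m)) *
        ((∑ i ∈ Finset.range k, b i) - k).factorial) ∨
    (∏ m ∈ Finset.range k, ((∑ i ∈ Finset.range (m + 1), (b i : ℤ)) - m) = 0 ∧
      (∏ j ∈ Finset.range (∑ i ∈ Finset.range k, b i), ((j : ℤ) + 2 - firstReach b (j + 1)) = 0 ∨
        ∑ i ∈ Finset.range k, b i < k)) := by
  induction k with
  | zero => simp
  | succ k ih =>
    set A := ∑ i ∈ Finset.range k, b i with hA
    have hA' : ∑ i ∈ Finset.range (k + 1), b i = A + b k := Finset.sum_range_succ _ _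
    have hAz : ∑ i ∈ Finset.range (k + 1), (b i : ℤ) = A + b k := by
      rw [← Nat.cast_sum, hA']; push_cast; rfl
    have hr : ∀ j, A ≤ j → j < A + b k → firstReach b (j + 1) = k + 1 := fun j h1 h2 =>
      firstReach_eq (by omega) (by omega)
    rw [Finset.prod_range_succ, hAz, hA']
    obtain h0 | h1 | h2 : b k = 0 ∨ b k = 1 ∨ b k = 2 := by have := hb k; omega
    · rw [h0, add_zero]
      rcases ih with ⟨hk, ih⟩ | ⟨hz, ih⟩
      · rcases hk.eq_or_lt with hk | hk
        · right
          refine ⟨?_, Or.inr (by omega)⟩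
          rw [← hk]; simp
        · left
          refine ⟨hk, ?_⟩
          obtain ⟨c, hc⟩ := Nat.exists_eq_add_of_lt hk
          rw [ih, hc, show k + c + 1 - k = c + 1 by omega, show k + c + 1 - (k + 1) = c by omega,
            Nat.factorial_succ]
          push_cast
          ring
      · right
        refine ⟨by rw [hz, zero_mul], ih.imp_right (by omega)⟩
    · rw [h1, Finset.prod_range_succ, hr A le_rfl (by omega)]
      rcases ih with ⟨hk, ih⟩ | ⟨hz, ih⟩
      · left
        refine ⟨by omega, ?_⟩
        obtain ⟨c, hc⟩ := Nat.exists_eq_add_of_le hk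
        rw [ih, hc, show k + c - k = c by omega, show k + c + 1 - (k + 1) = c by omega]
        push_cast
        ring
      · right
        exact ⟨by rw [hz, zero_mul], ih.imp (fun h => by rw [h, zero_mul]) (by omega)⟩
    · rw [h2, Finset.prod_range_succ, Finset.prod_range_succ, hr A le_rfl (by omega),
        hr (A + 1) (by omega) (by omega)]
      rcases ih with ⟨hk, ih⟩ | ⟨hz, ih⟩
      · left
        refine ⟨by omega, ?_⟩
        obtain ⟨c, hc⟩ := Nat.exists_eq_add_of_le hk
        rw [ih, hc, show k + c - k = c by omega, show k + c + 2 - (k + 1) = c + 1 by omega,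
          Nat.factorial_succ]
        push_cast
        ring
      · right
        refine ⟨by rw [hz, zero_mul], ?_⟩
        rcases ih with h | h
        · left; rw [h, zero_mul, zero_mul]
        -- A deficit is made good only by a part 2 at `A + 1 = k`, and the first new dale factor is
        -- then 0.
        · rcases (show A + 1 = k ∨ A + 2 < k + 1 by omega) with h | h
          · left
            rw [← h]
            push_cast
            ring
          · exact Or.inr h

theorem prod_excess_eq_prod_firstReach (b : ℕ → ℕ) (hb : ∀ i, b i ≤ 2) {k : ℕ}
    (hk : ∑ i ∈ Finset.range k, b i = k) :
    ∏ m ∈ Finset.range k, ((∑ i ∈ Finset.range (m + 1), (b i : ℤ)) - m) =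
      ∏ j ∈ Finset.range k, ((j : ℤ) + 2 - firstReach b (j + 1)) := by
  rcases prod_excess_eq_prod_firstReach_aux b hb k with h | h <;> rw [hk] at h
  · simpa using h.2.symm
  · rcases h.2 with h' | h'
    · rw [h.1, h']
    · omega

/-! ### Compositions as sequences on the natural numbers -/

/-- A finite sequence, extended by zeros. -/
def extend {k : ℕ} (α : Fin k → ℕ) (i : ℕ) : ℕ := if h : i < k then α ⟨i, h⟩ else 0

theorem sum_filter_lt_eq_sum_extend {k : ℕ} (α : Fin k → ℕ) (i : ℕ) :
    ∑ m ∈ Finset.univ.filter (fun m : Fin k => (m : ℕ) < i), α m =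
      ∑ m ∈ Finset.range i, extend α m := by
  rw [Finset.sum_filter]
  have h : ∀ m : Fin k, (if (m : ℕ) < i then α m else 0) =
      (fun m : ℕ => if m < i then extend α m else 0) m := by
    intro m
    simp [extend]
  rw [Finset.sum_congr rfl fun m _ => h m,
    Fin.sum_univ_eq_sum_range (fun m : ℕ => if m < i then extend α m else 0), ← Finset.sum_filter]
  apply Finset.sum_subset
  · intro m hm
    simp only [Finset.mem_filter, Finset.mem_range] at hm ⊢
    exact hm.2
  · intro m hm hm'
    simp only [Finset.mem_filter, Finset.mem_range, not_and] at hm hm'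
    rw [extend, dif_neg fun h => hm' h hm]

theorem sum_eq_sum_range_extend {k : ℕ} (α : Fin k → ℕ) :
    ∑ m, α m = ∑ m ∈ Finset.range k, extend α m := by
  rw [← sum_filter_lt_eq_sum_extend]
  simp

theorem rank_eq_firstReach {k : ℕ} (α : Fin k → ℕ) (j : ℕ) :
    rank α j = firstReach (extend α) j := by
  simp only [rank, firstReach, sum_filter_lt_eq_sum_extend]

theorem extend_twoPlus_zero {k : ℕ} (α : Fin k → ℕ) : extend (twoPlus α) 0 = 2 := by
  simp [extend, twoPlus]

theorem extend_twoPlus_succ {k : ℕ} (α : Fin k → ℕ) (i : ℕ) :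
    extend (twoPlus α) (i + 1) = extend α i := by
  by_cases h : i < k
  · rw [extend, extend, dif_pos h, dif_pos (by omega)]
    exact Fin.cons_succ (α := fun _ => ℕ) 2 α ⟨i, h⟩
  · rw [extend, extend, dif_neg h, dif_neg (by omega)]

theorem extend_le {k c : ℕ} {α : Fin k → ℕ} (h : ∀ i, α i ≤ c) (i : ℕ) : extend α i ≤ c := by
  rw [extend]
  split_ifs
  · exact h _
  · exact c.zero_le

theorem ones_eq_card {k : ℕ} (α : Fin k → ℕ) :
    ones α = (List.range k).countP fun i => extend α i = 1 := by
  rw [ones, ← List.map_coe_finRange_eq_range, List.countP_map, List.countP_eq_length_filter]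
  simp [extend, Function.comp_def, Finset.card, Finset.filter, Fin.univ_def]

theorem ones_twoPlus {k : ℕ} (α : Fin k → ℕ) :
    ((List.range (k + 1)).countP fun i => extend (twoPlus α) i = 1) = ones α := by
  rw [List.range_succ_eq_map, List.countP_cons, List.countP_map, ones_eq_card,
    extend_twoPlus_zero]
  simp only [Function.comp_def, Nat.succ_eq_add_one, extend_twoPlus_succ]
  simp

/-! ### Sorted pinnacles, gaps and δ -/

theorem elt_zero (n : ℕ) (S : Finset ℕ) : elt n S 0 = 0 := by simp [elt]

theorem elt_succ {n : ℕ} {S : Finset ℕ} {i : ℕ} (hi : i < S.card) :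
    elt n S (i + 1) = (S.sort (· ≤ ·))[i]'(by simpa using hi) := by
  have : i < (S.sort (· ≤ ·)).length := by simpa using hi
  rw [elt, List.getD_cons_succ, List.getD_append _ _ _ _ this, List.getD_eq_getElem _ _ this]

theorem map_elt_range (n : ℕ) (S : Finset ℕ) :
    (List.range S.card).map (fun i => elt n S (i + 1)) = S.sort (· ≤ ·) := by
  apply List.ext_getElem
  · simp
  · intro i h1 h2
    simp only [List.getElem_map, List.getElem_range]
    exact elt_succ (by simpa using h1)

theorem elt_lt_elt {n : ℕ} {S : Finset ℕ} {i j : ℕ} (hij : i < j) (hj : j < S.card) :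
    elt n S (i + 1) < elt n S (j + 1) := by
  rw [elt_succ (hij.trans hj), elt_succ hj]
  exact List.pairwise_iff_getElem.1 (Finset.sortedLT_sort S).pairwise _ _ _ _ hij

theorem elt_lt_elt_iff {n : ℕ} {S : Finset ℕ} {i j : ℕ} (hi : i < S.card) (hj : j < S.card) :
    elt n S (i + 1) < elt n S (j + 1) ↔ i < j := by
  refine ⟨fun h => ?_, fun h => elt_lt_elt h hj⟩
  by_contra hji
  rcases (not_lt.1 hji).eq_or_lt with rfl | hji
  · exact lt_irrefl _ h
  · exact lt_asymm h (elt_lt_elt hji hi)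

theorem elt_mem {n : ℕ} {S : Finset ℕ} {i : ℕ} (hi : i < S.card) : elt n S (i + 1) ∈ S := by
  rw [elt_succ hi, ← Finset.mem_sort (· ≤ ·)]
  exact List.getElem_mem _

theorem elt_pos {n : ℕ} {S : Finset ℕ} (hS : ∀ s ∈ S, 1 ≤ s) {i : ℕ} (hi : i < S.card) :
    elt n S i < elt n S (i + 1) := by
  cases i with
  | zero => rw [elt_zero]; exact hS _ (elt_mem hi)
  | succ i => exact elt_lt_elt i.lt_succ_self hi

theorem sum_gap_add {n : ℕ} {S : Finset ℕ} (hS : ∀ s ∈ S, 1 ≤ s) {r : ℕ} (hr : r ≤ S.card) :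
    ∑ i ∈ Finset.range r, gap n S i + r = elt n S r := by
  induction r with
  | zero => simp [elt_zero]
  | succ r ih =>
    have h1 := elt_pos (n := n) hS (show r < S.card by omega)
    have h2 := ih (by omega)
    rw [Finset.sum_range_succ, gap]
    omega

/-- The bound on `j` depends only on its rank, so the last `j` of each rank is the binding one.
Since `1 ≤ b 0`, every partial sum is an admissible value of `j`. -/
theorem forall_le_sum_gap_iff {n : ℕ} {S : Finset ℕ} (hS : ∀ s ∈ S, 1 ≤ s) {b : ℕ → ℕ}
    (hb : 1 ≤ b 0) :
    (∀ j ∈ Finset.Icc 1 (∑ i ∈ Finset.range S.card, b i),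
      j ≤ ∑ i ∈ Finset.range (firstReach b j), gap n S i) ↔
    ∀ r < S.card, ∑ i ∈ Finset.range (r + 1), b i + (r + 1) ≤ elt n S (r + 1) := by
  have hmono : ∀ (f : ℕ → ℕ) {r s : ℕ}, r ≤ s →
      ∑ i ∈ Finset.range r, f i ≤ ∑ i ∈ Finset.range s, f i := fun f r s h =>
    Finset.sum_le_sum_of_subset (Finset.range_mono h)
  constructor
  · intro h r hr
    have h1 : firstReach b (∑ i ∈ Finset.range (r + 1), b i) ≤ r + 1 := Nat.sInf_le (Set.mem_ofPred.2 le_rfl)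
    have h2 := h (∑ i ∈ Finset.range (r + 1), b i) (Finset.mem_Icc.2
      ⟨hb.trans (by simpa using hmono b (show 1 ≤ r + 1 by omega)), hmono b hr⟩)
    have h3 := hmono (gap n S) h1
    have h4 := sum_gap_add (n := n) hS (r := r + 1) hr
    omega
  · intro h j hj
    rw [Finset.mem_Icc] at hj
    have hle : firstReach b j ≤ S.card := Nat.sInf_le hj.2
    have hmem : j ≤ ∑ i ∈ Finset.range (firstReach b j), b i :=
      Nat.sInf_mem (s := {i : ℕ | j ≤ ∑ m ∈ Finset.range i, b m}) ⟨S.card, hj.2⟩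
    have h4 := sum_gap_add (n := n) hS hle
    cases hr : firstReach b j with
    | zero => rw [hr] at hmem; simp at hmem; omega
    | succ r =>
      rw [hr] at hmem h4 hle
      have := h r hle
      omega

theorem delta_eq {n : ℕ} {S : Finset ℕ} (hS : ∀ s ∈ S, 1 ≤ s) {k : ℕ} (hk : S.card = k + 1)
    (α : Fin k → ℕ) [Decidable (∀ r < S.card,
      ∑ i ∈ Finset.range (r + 1), extend (twoPlus α) i + (r + 1) ≤ elt n S (r + 1))] :
    delta n S (twoPlus α) = if ∀ r < S.card,
      ∑ i ∈ Finset.range (r + 1), extend (twoPlus α) i + (r + 1) ≤ elt n S (r + 1)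
      then 1 else 0 := by
  have h := forall_le_sum_gap_iff (n := n) hS (b := extend (twoPlus α))
    (by rw [extend_twoPlus_zero]; omega)
  have hsum : ∑ i, twoPlus α i = ∑ i ∈ Finset.range S.card, extend (twoPlus α) i := by
    rw [hk, sum_eq_sum_range_extend]
  rw [delta, hsum]
  simp only [rank_eq_firstReach, h]

/-- The number of orderings with dale profile `2 ⊕ α`, in the two forms of the product. -/
theorem excessProd_twoPlus {k : ℕ} (α : Fin k → ℕ) (hα : ∀ i, α i ≤ 2) (hsum : ∑ i, α i = k) :
    excessProd ((List.range (k + 1)).map fun i => (extend (twoPlus α) i : ℤ)).reverse =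
      ∏ i ∈ Finset.range k, ((k : ℤ) + 1 + 1 - i - (daleRank α (k - i) : ℤ)) := by
  rw [excessProd_reverse_map_range, Finset.prod_range_succ']
  -- The leading part 2 contributes the factor 1 at index 0 and raises all later excesses by 1.
  have h1 : ∀ m, (∑ i ∈ Finset.range (m + 1 + 1), (extend (twoPlus α) i : ℤ)) - ((m + 1 : ℕ) + 1) =
      (∑ i ∈ Finset.range (m + 1), (extend α i : ℤ)) - m := by
    intro m
    rw [Finset.sum_range_succ', extend_twoPlus_zero]
    simp only [extend_twoPlus_succ]
    push_cast
    ring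
  simp only [h1]
  -- The target product runs through the dales from the largest down, hence the reflection.
  rw [prod_excess_eq_prod_firstReach _ (extend_le hα) (by rw [← sum_eq_sum_range_extend, hsum]),
    ← Finset.prod_range_reflect]
  have h0 : ∑ i ∈ Finset.range (0 + 1), (extend (twoPlus α) i : ℤ) = 2 := by
    simp [extend_twoPlus_zero]
  rw [h0]
  norm_num
  apply Finset.prod_congr rfl
  intro i hi
  rw [Finset.mem_range] at hi
  rw [daleRank, rank_eq_firstReach, show k - 1 - i + 1 = k - i by omega,
    show k - 1 - i = k - (i + 1) by omega, Nat.cast_sub (by omega)]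
  push_cast
  ring

/-! ### Grouping the orderings by dale profile -/

theorem nodup_permutations'_of_nodup {l : List ℕ} (h : l.Nodup) : l.permutations'.Nodup :=
  (l.permutations_perm_permutations'.nodup_iff).1 (List.nodup_permutations l h)

theorem sum_eq_sum_elt (n : ℕ) (S : Finset ℕ) (f : ℕ → ℕ) :
    ∑ j ∈ S, f j = ∑ i ∈ Finset.range S.card, f (elt n S (i + 1)) := by
  rw [← List.toFinset_range, List.sum_toFinset _ List.nodup_range]
  conv_lhs => rw [← Finset.sort_toFinset S (· ≤ ·), List.sum_toFinset _ (Finset.sort_nodup _ _)]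
  rw [← map_elt_range n S, List.map_map]
  rfl

/-- At the pinnacle with index `r + 1`, the relevant dales are those of rank at most `r + 1`, and
exactly `r` pinnacles lie below. -/
theorem dalesFit_iff {n : ℕ} {S : Finset ℕ} (hne : S.Nonempty) (hS : ∀ s ∈ S, s ≤ n) {b : ℕ → ℕ}
    {σ : List ℕ} (hσ : σ.Perm (S.sort (· ≤ ·)))
    (hb : ∀ i < S.card, (daleMins (n + 1) σ).count (elt n S (i + 1)) = b i) :
    DalesFit (n + 1) σ ↔
      ∀ r < S.card, ∑ i ∈ Finset.range (r + 1), b i + (r + 1) ≤ elt n S (r + 1) := by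
  have hmem : ∀ x, x ∈ σ ↔ x ∈ S := fun x => by rw [hσ.mem_iff, Finset.mem_sort]
  have hσne : σ ≠ [] := by
    obtain ⟨x, hx⟩ := hne
    exact List.ne_nil_of_mem ((hmem x).2 hx)
  have hnd : σ.Nodup := hσ.nodup_iff.2 (Finset.sort_nodup _ _)
  have hle : ∀ r < S.card,
      (daleMins (n + 1) σ).countP (· ≤ elt n S (r + 1)) = ∑ i ∈ Finset.range (r + 1), b i := by
    intro r hr
    rw [countP_eq_sum_ite_count S (· ≤ elt n S (r + 1)), sum_eq_sum_elt n]
    · rw [← Finset.sum_filter]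
      have : (Finset.range S.card).filter (fun i => elt n S (i + 1) ≤ elt n S (r + 1)) =
          Finset.range (r + 1) := by
        ext i
        simp only [Finset.mem_filter, Finset.mem_range]
        constructor
        · rintro ⟨h1, h2⟩
          rw [← not_lt, elt_lt_elt_iff hr h1] at h2
          omega
        · intro h
          have hi : i < S.card := by omega
          refine ⟨hi, ?_⟩
          rw [← not_lt, elt_lt_elt_iff hr hi]
          omega
      rw [this]
      exact Finset.sum_congr rfl fun i hi => hb i (by rw [Finset.mem_range] at hi; omega)
    · intro z hz _
      exact (hmem z).1 (mem_of_mem_daleMins_of_le hσne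
        (fun s hs => (hS s ((hmem s).1 hs)).trans n.le_succ) hz)
  have hlt : ∀ r < S.card, σ.countP (· < elt n S (r + 1)) = r := by
    intro r hr
    rw [countP_eq_sum_ite_count S (· < elt n S (r + 1)) σ (fun z hz _ => (hmem z).1 hz),
      sum_eq_sum_elt n, ← Finset.sum_filter]
    have : (Finset.range S.card).filter (fun i => elt n S (i + 1) < elt n S (r + 1)) =
        Finset.range r := by
      ext i
      simp only [Finset.mem_filter, Finset.mem_range]
      constructor
      · rintro ⟨h1, h2⟩
        exact (elt_lt_elt_iff h1 hr).1 h2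
      · intro h
        exact ⟨h.trans hr, elt_lt_elt h hr⟩
    rw [this, Finset.sum_congr rfl (g := fun _ => 1)]
    · simp
    · intro i hi
      exact List.count_eq_one_of_mem hnd ((hmem _).2 (elt_mem ((Finset.mem_range.1 hi).trans hr)))
  constructor
  · intro h r hr
    have := h _ ((hmem _).2 (elt_mem (n := n) hr))
    rw [hle r hr, hlt r hr] at this
    omega
  · intro h t ht
    rw [hσ.mem_iff, ← map_elt_range n S, List.mem_map] at ht
    obtain ⟨r, hr, rfl⟩ := ht
    rw [List.mem_range] at hr
    rw [hle r hr, hlt r hr]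
    have := h r hr
    omega

theorem mem_pin_le {n : ℕ} {π : Equiv.Perm (Fin n)} {s : ℕ} (hs : s ∈ pin π) : 1 ≤ s ∧ s ≤ n := by
  obtain ⟨i, -, rfl⟩ := Finset.mem_image.1 hs
  have := (π i).2
  omega

theorem mem_admissibleOrderings_iff {n : ℕ} {S : Finset ℕ} (hne : S.Nonempty)
    (hS : ∀ s ∈ S, 1 ≤ s ∧ s ≤ n) {σ : List ℕ} :
    σ ∈ admissibleOrderings n S ↔ σ.Perm (S.sort (· ≤ ·)) ∧ DalesFit (n + 1) σ := by
  constructor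
  · rintro ⟨hnd, rfl, π, -, rfl⟩
    refine ⟨?_, dalesFit_pinWord π⟩
    rw [List.perm_ext_iff_of_nodup hnd (Finset.sort_nodup _ _)]
    simp
  · rintro ⟨hperm, hfit⟩
    have hmem : ∀ x, x ∈ σ ↔ x ∈ S := fun x => by rw [hperm.mem_iff, Finset.mem_sort]
    have hnd : σ.Nodup := hperm.nodup_iff.2 (Finset.sort_nodup _ _)
    obtain ⟨x, hx⟩ := hne
    obtain ⟨π, hπ⟩ := exists_pinWord_eq (List.ne_nil_of_mem ((hmem x).2 hx)) hnd
      (fun s hs => hS s ((hmem s).1 hs)) hfit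
    have hset : σ.toFinset = S := by ext x; simp [hmem]
    exact ⟨hnd, hset, π, by rw [pin_eq_toFinset, hπ, hset], hπ⟩

/-- The dale profile of an ordering: the numbers of dales of the ranks `2, 3, …, k + 1`. -/
def daleProfile (n : ℕ) (S : Finset ℕ) (k : ℕ) (σ : List ℕ) (i : Fin k) : ℕ :=
  (daleMins (n + 1) σ).count (elt n S (i + 1 + 1))

theorem count_daleMins_elt_one {n k : ℕ} {S : Finset ℕ} (hk : S.card = k + 1)
    (hS : ∀ s ∈ S, 1 ≤ s ∧ s ≤ n) {σ : List ℕ} (hσ : σ.Perm (S.sort (· ≤ ·))) :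
    (daleMins (n + 1) σ).count (elt n S 1) = 2 := by
  have hmem : elt n S (0 + 1) ∈ S := elt_mem (by omega)
  have hnd : σ.Nodup := hσ.nodup_iff.2 (Finset.sort_nodup _ _)
  rw [count_daleMins_of_min σ _ (Nat.lt_succ_of_le (hS _ hmem).2) _ hnd,
    List.count_eq_one_of_mem hnd]
  · rwa [hσ.mem_iff, Finset.mem_sort]
  · intro s hs
    rw [hσ.mem_iff, ← map_elt_range n S, List.mem_map] at hs
    obtain ⟨i, hi, rfl⟩ := hs
    rw [List.mem_range] at hi
    rcases i.eq_zero_or_pos with rfl | h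
    · rfl
    · exact (elt_lt_elt h hi).le

theorem daleProfile_eq_iff {n k : ℕ} {S : Finset ℕ} (hk : S.card = k + 1)
    (hS : ∀ s ∈ S, 1 ≤ s ∧ s ≤ n) {σ : List ℕ} (hσ : σ.Perm (S.sort (· ≤ ·)))
    (α : Fin k → ℕ) : daleProfile n S k σ = α ↔
      ∀ i < S.card, (daleMins (n + 1) σ).count (elt n S (i + 1)) = extend (twoPlus α) i := by
  constructor
  · rintro rfl i hi
    cases i with
    | zero => rw [extend_twoPlus_zero, count_daleMins_elt_one hk hS hσ]
    | succ i => rw [extend_twoPlus_succ, extend, dif_pos (by omega), daleProfile]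
  · intro h
    funext i
    rw [daleProfile, h (i + 1) (by omega), extend_twoPlus_succ, extend, dif_pos i.2]

/-- Of the `k + 2` dales exactly two have rank 1, and no pinnacle touches more than two. -/
theorem daleProfile_mem_compositions {n k : ℕ} {S : Finset ℕ} (hk : S.card = k + 1)
    (hS : ∀ s ∈ S, 1 ≤ s ∧ s ≤ n) {σ : List ℕ} (hσ : σ.Perm (S.sort (· ≤ ·))) :
    (∀ i, daleProfile n S k σ i ≤ 2) ∧ ∑ i, daleProfile n S k σ i = k := by
  have hmem : ∀ x, x ∈ σ ↔ x ∈ S := fun x => by rw [hσ.mem_iff, Finset.mem_sort]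
  have hnd : σ.Nodup := hσ.nodup_iff.2 (Finset.sort_nodup _ _)
  constructor
  · intro i
    have hi : elt n S (i + 1 + 1) ∈ S := elt_mem (by omega)
    have h1 := count_daleMins_le (elt n S (i + 1 + 1)) σ (n + 1)
    rw [List.count_eq_one_of_mem hnd ((hmem _).2 hi), if_neg (by have := hS _ hi; omega)] at h1
    exact h1
  · have h1 := countP_eq_sum_ite_count S (fun _ => True) (daleMins (n + 1) σ) (by
      intro z hz _
      refine (hmem z).1 (mem_of_mem_daleMins_of_le ?_
        (fun s hs => (hS s ((hmem s).1 hs)).2.trans n.le_succ) hz)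
      exact List.ne_nil_of_mem ((hmem _).2 (elt_mem (n := n) (i := 0) (by omega))))
    rw [sum_eq_sum_elt n, hk, Finset.sum_range_succ'] at h1
    simp only [if_true, zero_add, count_daleMins_elt_one hk hS hσ, decide_true,
      List.countP_true, length_daleMins, hσ.length_eq, Finset.length_sort, hk] at h1
    rw [← Fin.sum_univ_eq_sum_range
      (fun i => (daleMins (n + 1) σ).count (elt n S (i + 1 + 1)))] at h1
    simp only [daleProfile]
    omega

theorem countP_daleProfile_eq {n k : ℕ} {S : Finset ℕ} (hk : S.card = k + 1)
    (hS : ∀ s ∈ S, 1 ≤ s ∧ s ≤ n) (α : Fin k → ℕ) (hα : ∀ i, α i ≤ 2) (hsum : ∑ i, α i = k) :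
    ((S.sort (· ≤ ·)).reverse.permutations'.countP (fun σ => daleProfile n S k σ = α) : ℤ) =
      2 ^ ones α * ∏ i ∈ Finset.range k, ((k : ℤ) + 1 + 1 - i - (daleRank α (k - i) : ℤ)) := by
  set u := S.sort (· ≤ ·) with hu
  have hund : u.Nodup := Finset.sort_nodup _ _
  have hmap : (List.range (k + 1)).map (fun i => elt n S (i + 1)) = u := by
    rw [← hk]; exact map_elt_range n S
  -- `profileCount` is indexed by entries, so the composition is carried from ranks to pinnacles.
  set a : ℕ → ℤ := fun x => extend (twoPlus α) (u.idxOf x) with ha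
  have hae : ∀ i < k + 1, a (elt n S (i + 1)) = extend (twoPlus α) i := by
    intro i hi
    rw [ha]
    simp only
    rw [elt_succ (by omega), List.Nodup.idxOf_getElem hund]
  have hmem : ∀ x, x ∈ u.reverse → ∃ i < k + 1, elt n S (i + 1) = x := by
    intro x hx
    rw [List.mem_reverse, ← hmap, List.mem_map] at hx
    obtain ⟨i, hi, rfl⟩ := hx
    exact ⟨i, List.mem_range.1 hi, rfl⟩
  have hmapa : u.map a = (List.range (k + 1)).map fun i => (extend (twoPlus α) i : ℤ) := by
    rw [← hmap, List.map_map]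
    exact List.map_congr_left fun i hi => hae i (List.mem_range.1 hi)
  have htwo : ∀ i, twoPlus α i ≤ 2 := fun i => Fin.cases le_rfl hα i
  have hcount : (u.reverse.permutations'.countP (fun σ => daleProfile n S k σ = α)) =
      profileCount (n + 1) u.reverse a := by
    apply List.countP_congr
    intro σ hσ
    have hσ' : σ.Perm u := (List.mem_permutations'.1 hσ).trans (List.reverse_perm u)
    simp only [decide_eq_true_eq]
    rw [daleProfile_eq_iff hk hS hσ', hk]
    constructor
    · intro h x hx
      obtain ⟨i, hi, rfl⟩ := hmem x hx
      rw [h i hi, hae i hi]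
    · intro h i hi
      have h1 := h (elt n S (i + 1)) (by
        rw [List.mem_reverse, hu, Finset.mem_sort]; exact elt_mem (by omega))
      rw [hae i hi] at h1
      exact_mod_cast h1
  rw [hcount, profileCount_eq]
  · rw [List.map_reverse, hmapa, excessProd_twoPlus α hα hsum, ← ones_twoPlus,
      List.countP_reverse, ← hmap, List.countP_map]
    congr 2
    apply List.countP_congr
    intro i hi
    simp [hae i (List.mem_range.1 hi)]
  · rw [List.pairwise_reverse]
    exact (Finset.sortedLT_sort S).pairwise
  · intro x hx
    rw [List.mem_reverse, hu, Finset.mem_sort] at hx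
    have := hS x hx
    omega
  · intro h
    have := congrArg List.length h
    simp [hu, hk] at this
  · intro x hx
    obtain ⟨i, hi, rfl⟩ := hmem x hx
    rw [hae i hi]
    have := extend_le htwo i
    omega
  · have h0 : ∑ i, twoPlus α i = k + 2 := by
      rw [Fin.sum_univ_succ]
      simp [twoPlus, hsum, add_comm]
    rw [List.map_reverse, List.sum_reverse, hmapa, ← List.sum_toFinset _ List.nodup_range,
      List.toFinset_range, ← Nat.cast_sum, ← sum_eq_sum_range_extend, h0]
    simp [hu, hk]
    ring

theorem ncard_admissibleOrderings {n k : ℕ} {S : Finset ℕ} (hk : S.card = k + 1)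
    (hS : ∀ s ∈ S, 1 ≤ s ∧ s ≤ n) :
    ((admissibleOrderings n S).ncard : ℤ) =
      ∑ α ∈ (Fintype.piFinset (fun _ : Fin k => Finset.Icc 0 2)).filter (fun α => ∑ i, α i = k),
        delta n S (twoPlus α) * 2 ^ ones α *
          ∏ i ∈ Finset.range k, ((k : ℤ) + 1 + 1 - i - (daleRank α (k - i) : ℤ)) := by
  classical
  have hne : S.Nonempty := Finset.card_pos.1 (by omega)
  set l := (S.sort (· ≤ ·)).reverse with hl
  have hlnd : l.Nodup := List.nodup_reverse.2 (Finset.sort_nodup _ _)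
  have hmem : ∀ {σ}, σ ∈ l.permutations'.toFinset ↔ σ.Perm (S.sort (· ≤ ·)) := by
    intro σ
    rw [List.mem_toFinset, List.mem_permutations']
    exact ⟨fun h => h.trans (List.reverse_perm _), fun h => h.trans (List.reverse_perm _).symm⟩
  have hset : admissibleOrderings n S =
      (l.permutations'.toFinset.filter fun σ => DalesFit (n + 1) σ : Finset (List ℕ)) := by
    ext σ
    rw [mem_admissibleOrderings_iff hne hS, Finset.coe_filter, Set.mem_ofPred, hmem]
  rw [hset, Set.ncard_coe_finset, Finset.card_eq_sum_card_fiberwise (f := daleProfile n S k)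
    (t := (Fintype.piFinset (fun _ : Fin k => Finset.Icc 0 2)).filter (fun α => ∑ i, α i = k)),
    Nat.cast_sum]
  · apply Finset.sum_congr rfl
    intro α hα
    simp only [Finset.mem_filter, Fintype.mem_piFinset, Finset.mem_Icc] at hα
    rw [mul_assoc, ← countP_daleProfile_eq hk hS α (fun i => (hα.1 i).2) hα.2,
      delta_eq (fun s hs => (hS s hs).1) hk, Finset.filter_filter]
    -- The filling condition is constant on a fibre, which therefore survives whole or not at all.
    have hfit : ∀ σ ∈ l.permutations'.toFinset, (DalesFit (n + 1) σ ∧ daleProfile n S k σ = α) ↔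
        ((∀ r < S.card, ∑ i ∈ Finset.range (r + 1), extend (twoPlus α) i + (r + 1) ≤
          elt n S (r + 1)) ∧ daleProfile n S k σ = α) := by
      intro σ hσ
      refine and_congr_left fun h => ?_
      exact dalesFit_iff hne (fun s hs => (hS s hs).2) (hmem.1 hσ)
        ((daleProfile_eq_iff hk hS (hmem.1 hσ) α).1 h)
    rw [Finset.filter_congr hfit]
    split_ifs with h
    · simp only [eq_true h, true_and, one_mul]
      rw [List.countP_eq_length_filter, ← List.toFinset_card_of_nodup
        ((nodup_permutations'_of_nodup hlnd).filter _), List.toFinset_filter]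
      simp
    · simp [h]
  · intro σ hσ
    rw [Finset.mem_coe, Finset.mem_filter] at hσ
    have := daleProfile_mem_compositions hk hS (hmem.1 hσ.1)
    simp only [Finset.coe_filter, Fintype.mem_piFinset, Finset.mem_Icc, Set.mem_ofPred]
    exact ⟨fun i => ⟨Nat.zero_le _, this.1 i⟩, this.2⟩

end Pinnacle

theorem mainTheorem9 (n d : ℕ) (hd : 1 ≤ d) (S : Finset ℕ) (hcard : S.card = d)
    (hS : Pinnacle.IsAdmissible n S) :
    ((Pinnacle.admissibleOrderings n S).ncard : ℤ) =
      ∑ α ∈ Pinnacle.compositions d,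
        Pinnacle.delta n S (Pinnacle.twoPlus α) * 2 ^ Pinnacle.ones α *
          ∏ i ∈ Finset.range (d - 1),
            ((d : ℤ) + 1 - (i : ℤ) - (Pinnacle.daleRank α (d - 1 - i) : ℤ)) := by
  -- Admissibility serves only to place `S` inside {1, …, n}.
  obtain ⟨π, hπ⟩ := hS
  rw [Pinnacle.ncard_admissibleOrderings (k := d - 1) (by omega)
    (fun s hs => Pinnacle.mem_pin_le (hπ ▸ hs))]
  have hd' : ((d - 1 : ℕ) : ℤ) + 1 = d := by omega
  rw [hd']
  rfl
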